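/- Let $H$ be a finite-dimensional complex Hilbert space, let $\Phi : L(H) \to L(H)$ be a channel (a completely positive, trace-preserving linear map), and let $A \subseteq L(H)$ be a von Neumann subalgebra, that is, a $*$-subalgebra containing the identity $I$ of $H$. Write $\Psi^\dagger$ for the dual of a map $\Psi$ with respect to the trace: $\mathrm{Tr}(\Psi(\rho)X) = \mathrm{Tr}(\rho\,\Psi^\dagger(X))$. The algebra $A$ is called correctable for $\Phi$ if there is a channel $\mathcal R : L(H) \to A$ (completely positive and trace preserving) such that $\Phi^\dagger \circ \mathcal R^\dagger = \mathrm{id}_A$. A representation of $A$ on $H$ is a linear map $\pi : A \to L(H)$ with $\pi(ab) = \pi(a)\pi(b)$ and $\pi(a^*) = \pi(a)^*$ for all $a,b \in A$ (with $\pi(I) = I$ not required), and its generalized multiplicative domain is $$\mathcal M_\pi(\Phi) = \{ a \in A : \Phi(aX) = \pi(a)\Phi(X) \text{ and } \Phi(Xa) = \Phi(X)\pi(a) \text{ for all } X \in L(H) \}.$$ Then $A$ is correctable for $\Phi$ if and only if $A = \mathcal M_\pi(\Phi)$ for some representation $\pi : A \to L(H)$. Moreover, if $A$ is correctable for $\Phi$,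 then, with $R = \Phi(I)$, with $R^{+}$ its Moore--Penrose inverse and with $R^{+1/2}$ the positive square root of $R^{+}$, the formula $\pi(a) = R^{+1/2}\,\Phi(a)\,R^{+1/2}$ defines a representation $\pi$ of $A$ on $H$ for which $A = \mathcal M_\pi(\Phi)$. -/

import Mathlib

open scoped InnerProductSpace

noncomputable section

namespace OAQEC

variable {H : Type*} [NormedAddCommGroup H] [InnerProductSpace ℂ H]

/-- The trace of an operator on `H`. -/
def opTrace (T : H →L[ℂ] H) : ℂ := LinearMap.trace ℂ H (T : H →ₗ[ℂ] H)

/-- A channel on `L(H)`: a linear map that is completely positive (entrywise application to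
positive block matrices gives positive block matrices, of every size) and trace preserving. -/
structure IsChannel [CompleteSpace H]
    (Φ : (H →L[ℂ] H) →ₗ[ℂ] (H →L[ℂ] H)) : Prop where
  completelyPositive : ∀ (k : ℕ) (M : CStarMatrix (Fin k) (Fin k) (H →L[ℂ] H)),
    0 ≤ M → 0 ≤ M.map Φ
  tracePreserving : ∀ ρ : H →L[ℂ] H, opTrace (Φ ρ) = opTrace ρ

section Dual

variable [FiniteDimensional ℂ H]

/-- The operator `Φ†(X)`, written out in the matrix units `|bᵢ⟩⟨bⱼ|` of an orthonormal basis. It is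
characterized, independently of the basis, by `tr (Φ(ρ) X) = tr (ρ Φ†(X))` for all `ρ`; see
`opTrace_mul_dualMap` and `eq_dualMap`. -/
def dualMap (Φ : (H →L[ℂ] H) →ₗ[ℂ] (H →L[ℂ] H)) : (H →L[ℂ] H) →ₗ[ℂ] (H →L[ℂ] H) where
  toFun X := ∑ i, ∑ j,
    opTrace (Φ (InnerProductSpace.rankOne ℂ (stdOrthonormalBasis ℂ H i)
        (stdOrthonormalBasis ℂ H j)) * X) •
      InnerProductSpace.rankOne ℂ (stdOrthonormalBasis ℂ H j) (stdOrthonormalBasis ℂ H i)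
  map_add' X Y := by
    simp [opTrace, mul_add, add_smul, Finset.sum_add_distrib]
  map_smul' c X := by
    simp [opTrace, mul_smul, Finset.smul_sum]

theorem opTrace_rankOne_mul (x y : H) (T : H →L[ℂ] H) :
    opTrace (InnerProductSpace.rankOne ℂ x y * T) = ⟪y, T x⟫_ℂ := by
  have h1 : opTrace (InnerProductSpace.rankOne ℂ x y * T)
      = opTrace (T * InnerProductSpace.rankOne ℂ x y) := by
    unfold opTrace
    exact LinearMap.trace_mul_comm ℂ _ _
  rw [h1, ContinuousLinearMap.mul_def, InnerProductSpace.comp_rankOne]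
  exact InnerProductSpace.trace_rankOne _ _

theorem opTrace_mul_dualMap (Φ : (H →L[ℂ] H) →ₗ[ℂ] (H →L[ℂ] H)) (ρ X : H →L[ℂ] H) :
    opTrace (Φ ρ * X) = opTrace (ρ * dualMap Φ X) := by
  have hρ : ρ = ∑ i, ∑ j, ⟪stdOrthonormalBasis ℂ H i, ρ (stdOrthonormalBasis ℂ H j)⟫_ℂ •
      InnerProductSpace.rankOne ℂ (stdOrthonormalBasis ℂ H i) (stdOrthonormalBasis ℂ H j) := by
    ext x
    conv_lhs => rw [← (stdOrthonormalBasis ℂ H).sum_repr' x, map_sum]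
    simp only [map_smul, sum_apply, smul_apply,
      InnerProductSpace.rankOne_apply]
    rw [Finset.sum_comm]
    refine Finset.sum_congr rfl fun j _ => ?_
    conv_lhs => rw [← (stdOrthonormalBasis ℂ H).sum_repr' (ρ (stdOrthonormalBasis ℂ H j)),
      Finset.smul_sum]
    exact Finset.sum_congr rfl fun i _ => smul_comm _ _ _
  have hadd : ∀ S T : H →L[ℂ] H, opTrace (S + T) = opTrace S + opTrace T := by
    intro S T; simp [opTrace]
  have hsum : ∀ {ι : Type} (s : Finset ι) (f : ι → (H →L[ℂ] H)),
      opTrace (∑ i ∈ s, f i) = ∑ i ∈ s, opTrace (f i) := by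
    intro ι s f
    exact map_sum (AddMonoidHom.mk' opTrace hadd) f s
  have hsmul : ∀ (c : ℂ) (T : H →L[ℂ] H), opTrace (c • T) = c * opTrace T := by
    intro c T; simp [opTrace]
  have hcomm : ∀ S T : H →L[ℂ] H, opTrace (S * T) = opTrace (T * S) := by
    intro S T
    exact LinearMap.trace_mul_comm ℂ _ _
  conv_lhs => rw [hρ]
  have hX : dualMap Φ X = ∑ i, ∑ j,
      opTrace (Φ (InnerProductSpace.rankOne ℂ (stdOrthonormalBasis ℂ H i)
          (stdOrthonormalBasis ℂ H j)) * X) •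
        InnerProductSpace.rankOne ℂ (stdOrthonormalBasis ℂ H j) (stdOrthonormalBasis ℂ H i) := rfl
  rw [hX]
  simp only [map_sum, map_smul, Finset.sum_mul, Finset.mul_sum, hsum, smul_mul_assoc,
    mul_smul_comm, hsmul]
  refine Finset.sum_congr rfl fun i _ => Finset.sum_congr rfl fun j _ => ?_
  rw [hcomm ρ, opTrace_rankOne_mul, mul_comm]

theorem eq_dualMap (Φ Ψ : (H →L[ℂ] H) →ₗ[ℂ] (H →L[ℂ] H))
    (h : ∀ ρ X, opTrace (Φ ρ * X) = opTrace (ρ * Ψ X)) : Ψ = dualMap Φ := by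
  ext X x
  refine ext_inner_left ℂ fun y => ?_
  rw [← opTrace_rankOne_mul, ← opTrace_rankOne_mul, ← h, opTrace_mul_dualMap]

end Dual

/-- Correctability of a von Neumann subalgebra `A` of `L(H)` for `Φ`: there is a channel
`R : L(H) → A` with `Φ† ∘ R† = id_A`. As `A` carries the trace and the order of `L(H)`, `R` is a
channel into `A` exactly when it is one as a map into `L(H)`, and `R† : A → L(H)`, which is given by
`tr (R(ρ) X) = tr (ρ R†(X))` for `X ∈ A`, is the restriction to `A` of the dual of that map. -/
def IsCorrectable [FiniteDimensional ℂ H] [CompleteSpace H]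
    (Φ : (H →L[ℂ] H) →ₗ[ℂ] (H →L[ℂ] H)) (A : StarSubalgebra ℂ (H →L[ℂ] H)) : Prop :=
  ∃ R : (H →L[ℂ] H) →ₗ[ℂ] A,
    IsChannel (A.subtype.toAlgHom.toLinearMap ∘ₗ R) ∧
    ∀ X : A, dualMap Φ (dualMap (A.subtype.toAlgHom.toLinearMap ∘ₗ R) (X : H →L[ℂ] H)) = X

/-- The generalized multiplicative domain `M_π(Φ)` of a representation `π : A → L(H)`, which
is a linear, multiplicative and *-preserving map with no condition on `π(1)`. -/
def genMultDomain [CompleteSpace H] (Φ : (H →L[ℂ] H) →ₗ[ℂ] (H →L[ℂ] H))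
    (A : StarSubalgebra ℂ (H →L[ℂ] H)) (π : A →⋆ₙₐ[ℂ] (H →L[ℂ] H)) : Set (H →L[ℂ] H) :=
  {a | ∃ ha : a ∈ A, ∀ X : H →L[ℂ] H,
    Φ (a * X) = π ⟨a, ha⟩ * Φ X ∧ Φ (X * a) = Φ X * π ⟨a, ha⟩}

section PseudoInverse

theorem continuousOn_spectrum [FiniteDimensional ℂ H] (R : H →L[ℂ] H) (f : ℝ → ℝ) : ContinuousOn f (spectrum ℝ R) := by
  refine Set.Finite.continuousOn ?_ f
  have h1 : (spectrum ℂ R).Finite := by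
    have h2 := Module.End.finite_spectrum (K := ℂ) (R : H →ₗ[ℂ] H)
    rwa [← AlgEquiv.spectrum_eq (Module.End.toContinuousLinearMap H)] at h2
  rw [← spectrum.preimage_algebraMap (R := ℝ) ℂ]
  exact h1.preimage (Complex.ofReal_injective.injOn)

variable [CompleteSpace H]

/-- The Moore-Penrose inverse `R⁺` of a self-adjoint operator `R` on a finite-dimensional space:
invert the nonzero eigenvalues, and keep the eigenvalue zero. -/
def pinv (R : H →L[ℂ] H) : H →L[ℂ] H := cfc (fun x : ℝ => x⁻¹) R

/-- The positive square root `R^{+1/2}` of `R⁺`, for positive `R`. -/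
def pinvSqrt (R : H →L[ℂ] H) : H →L[ℂ] H := CFC.sqrt (pinv R)

/-- The four Penrose equations for `pinv`. -/
theorem pinv_penrose [FiniteDimensional ℂ H] (R : H →L[ℂ] H) (hR : IsSelfAdjoint R) :
    R * pinv R * R = R ∧ pinv R * R * pinv R = pinv R ∧
      IsSelfAdjoint (R * pinv R) ∧ IsSelfAdjoint (pinv R * R) := by
  have hc : ∀ f : ℝ → ℝ, ContinuousOn f (spectrum ℝ R) := continuousOn_spectrum R
  have h1 : R * pinv R = cfc (fun x : ℝ => x * x⁻¹) R := by
    rw [cfc_mul _ _ R (hc _) (hc _), cfc_id' ℝ R, pinv]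
  have h2 : pinv R * R = cfc (fun x : ℝ => x⁻¹ * x) R := by
    rw [cfc_mul _ _ R (hc _) (hc _), cfc_id' ℝ R, pinv]
  refine ⟨?_, ?_, ?_, ?_⟩
  · have h3 : cfc (fun x : ℝ => x * x⁻¹) R * cfc (fun x : ℝ => x) R = cfc (fun x : ℝ => x) R := by
      rw [← cfc_mul _ _ R (hc _) (hc _)]
      exact cfc_congr fun x _ => mul_inv_mul_cancel x
    rwa [cfc_id' ℝ R, ← h1] at h3
  · rw [h2, pinv, ← cfc_mul _ _ R (hc _) (hc _)]
    refine cfc_congr fun x _ => ?_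
    rcases eq_or_ne x 0 with rfl | hx <;> simp [*]
  · rw [h1]; exact cfc_predicate _ R
  · rw [h2]; exact cfc_predicate _ R

theorem pinvSqrt_spec (R : H →L[ℂ] H) (hR : 0 ≤ R) :
    0 ≤ pinvSqrt R ∧ pinvSqrt R * pinvSqrt R = pinv R := by
  have h : 0 ≤ pinv R := cfc_nonneg fun x hx => inv_nonneg.mpr (spectrum_nonneg_of_nonneg hR hx)
  exact ⟨CFC.sqrt_nonneg _, CFC.sqrt_mul_sqrt_self _ h⟩

end PseudoInverse

end OAQEC

end

namespace OAQEC

open scoped ComplexOrder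

/-! Suppose `R` corrects `A`, and let `X ∈ A`. Applying Kadison-Schwarz to `R†` and then to `Φ†`
squeezes `Φ†(R†(X)* R†(X))` between `X*X` and `X*X`, so Choi's theorem puts `R†(X)` in the
multiplicative domain of `Φ†`. Under trace duality this says `R†(X) Φ(ρ) = Φ(Xρ)`, together with its
adjoint (`intertwines_of_leftInverse`). Hence `R†(X)` commutes with `Φ(1)`. Compressing `Φ(X)` by
the root of the pseudoinverse gives `R†(X) P`, where `P` is the support projection of `Φ(1)`; this
is multiplicative and still intertwines, because every `Φ(ρ)` is supported on `P`
(`exists_representation`).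

Conversely, given `π`, put `E = 1 - π(1)`. The map `S(a) = π(a) + E a E` is unital and completely
positive, so its trace adjoint is a channel into `A`. Since `Φ(ρ) E = 0`, the corner term is
invisible to `Φ†`, and `Φ†(S(a)) = a` (`isCorrectable_of_intertwines`). -/

theorem exists_eq_star_mul_self_of_nonneg {B : Type*} [CStarAlgebra B] [PartialOrder B]
    [StarOrderedRing B] {b : B} (hb : 0 ≤ b) : ∃ c, b = star c * c :=
  CStarAlgebra.nonneg_iff_eq_star_mul_self.mp hb

/-! ### The trace as a faithful positive functional. -/

section Trace

variable {H : Type*} [NormedAddCommGroup H] [InnerProductSpace ℂ H]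

/-- The trace of an operator, as a linear functional. -/
noncomputable def opTraceₗ : (H →L[ℂ] H) →ₗ[ℂ] ℂ where
  toFun := opTrace
  map_add' S T := by simp [opTrace]
  map_smul' c T := by simp [opTrace]

theorem opTrace_eq_opTraceₗ (T : H →L[ℂ] H) : opTrace T = opTraceₗ T := rfl

theorem opTrace_add (S T : H →L[ℂ] H) : opTrace (S + T) = opTrace S + opTrace T :=
  map_add opTraceₗ S T

theorem opTrace_smul (c : ℂ) (T : H →L[ℂ] H) : opTrace (c • T) = c * opTrace T :=
  map_smul opTraceₗ c T

theorem opTrace_zero : opTrace (0 : H →L[ℂ] H) = 0 := map_zero opTraceₗ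

theorem opTrace_sum {ι : Type*} (s : Finset ι) (f : ι → (H →L[ℂ] H)) :
    opTrace (∑ i ∈ s, f i) = ∑ i ∈ s, opTrace (f i) := map_sum opTraceₗ f s

theorem opTrace_mul_comm (S T : H →L[ℂ] H) : opTrace (S * T) = opTrace (T * S) :=
  LinearMap.trace_mul_comm ℂ _ _

theorem nonneg_iff_inner {T : H →L[ℂ] H} : 0 ≤ T ↔ ∀ x, 0 ≤ ⟪x, T x⟫_ℂ := by
  rw [ContinuousLinearMap.nonneg_iff_isPositive]
  constructor
  · exact fun h x => h.inner_nonneg_right x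
  · intro h
    rw [ContinuousLinearMap.isPositive_iff_complex]
    intro x
    have h1 : ⟪T x, x⟫_ℂ = star ⟪x, T x⟫_ℂ := (inner_conj_symm _ _).symm
    have h2 : 0 ≤ ⟪T x, x⟫_ℂ := by rw [h1]; exact star_nonneg_iff.mpr (h x)
    rw [Complex.nonneg_iff] at h2
    exact ⟨Complex.ext rfl h2.2, h2.1⟩

variable [FiniteDimensional ℂ H]

theorem opTrace_eq_sum_inner (T : H →L[ℂ] H) :
    opTrace T = ∑ i, ⟪stdOrthonormalBasis ℂ H i, T (stdOrthonormalBasis ℂ H i)⟫_ℂ :=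
  LinearMap.trace_eq_sum_inner _ _

theorem ext_opTrace_mul {S T : H →L[ℂ] H} (h : ∀ ρ, opTrace (ρ * S) = opTrace (ρ * T)) :
    S = T := by
  ext x
  refine ext_inner_left ℂ fun y => ?_
  rw [← opTrace_rankOne_mul, ← opTrace_rankOne_mul, h]

variable [CompleteSpace H]

theorem opTrace_star (T : H →L[ℂ] H) : opTrace (star T) = star (opTrace T) := by
  simp only [opTrace_eq_sum_inner, star_sum]
  refine Finset.sum_congr rfl fun i _ => ?_
  rw [ContinuousLinearMap.star_eq_adjoint, ContinuousLinearMap.adjoint_inner_right]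
  exact (inner_conj_symm _ _).symm

theorem opTrace_star_mul_self (T : H →L[ℂ] H) :
    opTrace (star T * T) = ((∑ i, ‖T (stdOrthonormalBasis ℂ H i)‖ ^ 2 : ℝ) : ℂ) := by
  rw [opTrace_eq_sum_inner]
  push_cast
  refine Finset.sum_congr rfl fun i _ => ?_
  rw [ContinuousLinearMap.star_eq_adjoint, Function.comp_apply,
    ContinuousLinearMap.adjoint_inner_right, inner_self_eq_norm_sq_to_K]
  rfl

theorem opTrace_star_mul_self_nonneg (T : H →L[ℂ] H) : 0 ≤ opTrace (star T * T) := by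
  rw [opTrace_star_mul_self]
  exact Complex.zero_le_real.mpr (Finset.sum_nonneg fun i _ => sq_nonneg _)

theorem eq_zero_of_opTrace_star_mul_self {T : H →L[ℂ] H} (h : opTrace (star T * T) = 0) :
    T = 0 := by
  rw [opTrace_star_mul_self, Complex.ofReal_eq_zero,
    Finset.sum_eq_zero_iff_of_nonneg fun i _ => sq_nonneg _] at h
  have h1 : (T : H →ₗ[ℂ] H) = 0 := (stdOrthonormalBasis ℂ H).toBasis.ext fun i => by
    simpa using h i (Finset.mem_univ i)
  ext x
  exact congrArg (fun S : H →ₗ[ℂ] H => S x) h1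

theorem eq_zero_of_nonneg_of_opTrace {T : H →L[ℂ] H} (hT : 0 ≤ T) (h : opTrace T = 0) :
    T = 0 := by
  obtain ⟨Z, rfl⟩ := exists_eq_star_mul_self_of_nonneg hT
  rw [eq_zero_of_opTrace_star_mul_self h, mul_zero]

end Trace

/-! ### Complete positivity of a channel and of its dual. -/

section Dual

variable {H : Type*} [NormedAddCommGroup H] [InnerProductSpace ℂ H]
  [CompleteSpace H] {Φ : (H →L[ℂ] H) →ₗ[ℂ] (H →L[ℂ] H)}

theorem IsChannel.exists_star_mul_eq (hΦ : IsChannel Φ) {k : ℕ}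
    (N : CStarMatrix (Fin k) (Fin k) (H →L[ℂ] H)) :
    ∃ L : CStarMatrix (Fin k) (Fin k) (H →L[ℂ] H), ∀ i j,
      Φ (∑ l, star (N l i) * N l j) = ∑ l, star (L l i) * L l j := by
  obtain ⟨L, hL⟩ := exists_eq_star_mul_self_of_nonneg
    (hΦ.completelyPositive k _ (star_mul_self_nonneg N))
  refine ⟨L, fun i j => ?_⟩
  have h := congrArg (fun M : CStarMatrix (Fin k) (Fin k) (H →L[ℂ] H) => M i j) hL
  simpa [CStarMatrix.mul_apply, CStarMatrix.star_apply] using h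

theorem IsChannel.map_star (hΦ : IsChannel Φ) (T : H →L[ℂ] H) : Φ (star T) = star (Φ T) := by
  -- Here `N* N` has off-diagonal entries `T` and `T*`; the image block matrix is self-adjoint.
  let N : CStarMatrix (Fin 2) (Fin 2) (H →L[ℂ] H) := CStarMatrix.ofMatrix !![1, T; 0, 0]
  obtain ⟨L, hL⟩ := hΦ.exists_star_mul_eq N
  have h01 := hL 0 1
  have h10 := hL 1 0
  simp only [Fin.sum_univ_two, N, CStarMatrix.ofMatrix_apply] at h01 h10
  simp at h01 h10
  rw [h01, h10]
  simp

variable [FiniteDimensional ℂ H]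

theorem IsChannel.dualMap_one (hΦ : IsChannel Φ) : dualMap Φ 1 = 1 :=
  ext_opTrace_mul fun ρ => by
    rw [← opTrace_mul_dualMap, mul_one, mul_one, hΦ.tracePreserving]

theorem IsChannel.dualMap_star (hΦ : IsChannel Φ) (X : H →L[ℂ] H) :
    dualMap Φ (star X) = star (dualMap Φ X) :=
  ext_opTrace_mul fun ρ => by
    have h : opTrace (Φ ρ * star X) = star (opTrace (Φ (star ρ) * X)) := by
      rw [← opTrace_star, star_mul, hΦ.map_star, star_star, opTrace_mul_comm]
    rw [← opTrace_mul_dualMap, h, opTrace_mul_dualMap, ← opTrace_star, star_mul, star_star,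
      opTrace_mul_comm]

/-- Complete positivity of `Φ†` in quadratic-form guise. The blocks `|xⱼ⟩⟨xᵢ|` form a positive
matrix, so their images under `Φ` factor as `L* L`, and duality turns the sum into traces of
operators `W* W`. -/
theorem IsChannel.sum_inner_dualMap_nonneg (hΦ : IsChannel Φ) {k : ℕ} (x : Fin (k + 1) → H)
    (N : Fin (k + 1) → (H →L[ℂ] H)) :
    0 ≤ ∑ i, ∑ j, ⟪x i, dualMap Φ (star (N i) * N j) (x j)⟫_ℂ := by
  rcases subsingleton_or_nontrivial H with hH | hH
  · refine Finset.sum_nonneg fun i _ => Finset.sum_nonneg fun j _ => ?_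
    rw [Subsingleton.elim (x i) 0, inner_zero_left]
  obtain ⟨e, he⟩ := exists_norm_eq H zero_le_one
  -- Only row `0` is nonzero; as `e` is a unit vector, `V* V` has entries `|xⱼ⟩⟨xᵢ|`.
  let V : CStarMatrix (Fin (k + 1)) (Fin (k + 1)) (H →L[ℂ] H) :=
    CStarMatrix.ofMatrix fun l i => if l = 0 then InnerProductSpace.rankOne ℂ e (x i) else 0
  obtain ⟨L, hL⟩ := hΦ.exists_star_mul_eq V
  have hV : ∀ j i, ∑ l, star (V l j) * V l i = InnerProductSpace.rankOne ℂ (x j) (x i) := by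
    intro j i
    have hVl : ∀ l i, V l i = if l = 0 then InnerProductSpace.rankOne ℂ e (x i) else 0 :=
      fun _ _ => rfl
    rw [Finset.sum_eq_single 0]
    · ext z
      simp [hVl, ContinuousLinearMap.star_eq_adjoint, he]
    · intro l _ hl
      simp [hVl, hl]
    · simp
  have key : ∑ i, ∑ j, ⟪x i, dualMap Φ (star (N i) * N j) (x j)⟫_ℂ
      = ∑ l, opTrace (star (∑ i, L l i * star (N i)) * (∑ i, L l i * star (N i))) := by
    have h1 : ∀ i j, ⟪x i, dualMap Φ (star (N i) * N j) (x j)⟫_ℂ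
        = ∑ l, opTrace (N j * star (L l j) * (L l i * star (N i))) := by
      intro i j
      rw [← opTrace_rankOne_mul, ← opTrace_mul_dualMap, ← hV, hL, Finset.sum_mul, opTrace_sum]
      refine Finset.sum_congr rfl fun l _ => ?_
      rw [← mul_assoc, opTrace_mul_comm]
      simp only [mul_assoc]
    have h2 : ∀ l, opTrace (star (∑ i, L l i * star (N i)) * (∑ i, L l i * star (N i)))
        = ∑ i, ∑ j, opTrace (N j * star (L l j) * (L l i * star (N i))) := by
      intro l
      simp only [star_sum, star_mul, star_star, Finset.mul_sum, Finset.sum_mul, opTrace_sum]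
    simp only [h1, h2]
    rw [Finset.sum_comm (s := Finset.univ (α := Fin (k + 1)))
      (f := fun l i => ∑ j, opTrace (N j * star (L l j) * (L l i * star (N i))))]
    exact Finset.sum_congr rfl fun i _ => Finset.sum_comm
  rw [key]
  exact Finset.sum_nonneg fun l _ => opTrace_star_mul_self_nonneg _

end Dual

/-! ### Kadison-Schwarz, multiplicative domains and intertwining. -/

section MultiplicativeDomain

variable {H : Type*} [NormedAddCommGroup H] [InnerProductSpace ℂ H]
  [FiniteDimensional ℂ H] [CompleteSpace H]
  {Φ : (H →L[ℂ] H) →ₗ[ℂ] (H →L[ℂ] H)}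

/-- The Kadison-Schwarz inequality for the dual of a channel. -/
theorem IsChannel.star_dualMap_mul_dualMap_le (hΦ : IsChannel Φ) (Y : H →L[ℂ] H) :
    star (dualMap Φ Y) * dualMap Φ Y ≤ dualMap Φ (star Y * Y) := by
  rw [← sub_nonneg, nonneg_iff_inner]
  intro x
  -- With these vectors and operators the cross terms each contribute `-‖Φ†(Y)x‖²` and the first
  -- diagonal term `+‖Φ†(Y)x‖²`.
  have h := hΦ.sum_inner_dualMap_nonneg (k := 1) ![dualMap Φ Y x, x] ![-1, Y]
  rw [Fin.sum_univ_two, Fin.sum_univ_two, Fin.sum_univ_two] at h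
  have h1 : ⟪x, star (dualMap Φ Y) (dualMap Φ Y x)⟫_ℂ = ⟪dualMap Φ Y x, dualMap Φ Y x⟫_ℂ := by
    rw [ContinuousLinearMap.star_eq_adjoint, ContinuousLinearMap.adjoint_inner_right]
  simp only [Matrix.cons_val_zero, Matrix.cons_val_one, star_neg, star_one,
    neg_mul, mul_neg, one_mul, mul_one, neg_neg, map_neg, hΦ.dualMap_one, hΦ.dualMap_star,
    neg_apply, inner_neg_right, one_apply_eq_self, h1] at h
  rw [sub_apply, inner_sub_right, mul_apply_eq_comp, h1]
  convert h using 1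
  ring

theorem IsChannel.dualMap_mono (hΦ : IsChannel Φ) {X Y : H →L[ℂ] H} (h : X ≤ Y) :
    dualMap Φ X ≤ dualMap Φ Y := by
  obtain ⟨Z, hZ⟩ := exists_eq_star_mul_self_of_nonneg (sub_nonneg.mpr h)
  rw [← sub_nonneg, ← map_sub, hZ]
  exact (star_mul_self_nonneg _).trans (hΦ.star_dualMap_mul_dualMap_le Z)

theorem eq_zero_of_forall_nonneg (d c : ℂ)
    (h : ∀ t : ℂ, 0 ≤ star t * t * c + star t * d + t * star d) : d = 0 := by
  -- The terms linear in `t` cancel between `t = 1` and `t = -1`.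
  have hc : 0 ≤ c.re := by
    have h1 := Complex.nonneg_iff.mp (h 1)
    have h2 := Complex.nonneg_iff.mp (h (-1))
    simp at h1 h2
    linarith [h1.1, h2.1]
  -- At `t = -s d` the real part is `s|d|²(s c.re - 2)`, and this `s` makes `s c.re < 1`.
  set s : ℝ := (c.re + 1)⁻¹ with hs
  have hsp : 0 < s := by positivity
  have hsc : s * (c.re + 1) = 1 := inv_mul_cancel₀ (by positivity)
  have h3 := (Complex.nonneg_iff.mp (h (-(s : ℂ) * d))).1
  simp at h3
  have h5 : s * (d.re ^ 2 + d.im ^ 2) * (s * c.re - 2) ≥ 0 := by nlinarith [h3]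
  have h6 : s * c.re - 2 < 0 := by nlinarith
  have h7 : d.re ^ 2 + d.im ^ 2 ≤ 0 := by
    by_contra h8
    push Not at h8
    have := mul_pos hsp h8
    nlinarith
  apply Complex.ext <;> simp <;> nlinarith [sq_nonneg d.re, sq_nonneg d.im]

/-- Choi's theorem: equality in the Kadison-Schwarz inequality puts `a` in the multiplicative
domain. -/
theorem IsChannel.dualMap_mul_of_star_mul_self (hΦ : IsChannel Φ) {a : H →L[ℂ] H}
    (ha : dualMap Φ (star a * a) = star (dualMap Φ a) * dualMap Φ a) (Y : H →L[ℂ] H) :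
    dualMap Φ (Y * a) = dualMap Φ Y * dualMap Φ a := by
  -- `D` is the Kadison-Schwarz defect, a positive sesquilinear form with `D a a = 0`. As in
  -- Cauchy-Schwarz, a null vector is orthogonal to everything.
  let D : (H →L[ℂ] H) → (H →L[ℂ] H) → (H →L[ℂ] H) := fun X Z =>
    dualMap Φ (star X * Z) - star (dualMap Φ X) * dualMap Φ Z
  suffices h : ∀ x, ⟪D (star Y) a x, x⟫_ℂ = 0 by
    have h1 := (inner_map_self_eq_zero (D (star Y) a : H →ₗ[ℂ] H)).mp h
    have h2 : D (star Y) a = 0 := ContinuousLinearMap.coe_injective h1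
    simp only [D, star_star, hΦ.dualMap_star] at h2
    exact sub_eq_zero.mp h2
  intro x
  refine eq_zero_of_forall_nonneg _ ⟪D (star Y) (star Y) x, x⟫_ℂ fun t => ?_
  have h1 : 0 ≤ D (a + star t • star Y) (a + star t • star Y) :=
    sub_nonneg.mpr (hΦ.star_dualMap_mul_dualMap_le _)
  have h2 : D (a + star t • star Y) (a + star t • star Y)
      = (star (star t) * star t) • D (star Y) (star Y) + star (star t) • D (star Y) a
        + star t • star (D (star Y) a) := by
    have h3 : dualMap Φ (star a * star Y) = star (dualMap Φ (Y * a)) := by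
      rw [← hΦ.dualMap_star, star_mul]
    simp only [D, star_add, star_smul, star_star, add_mul, mul_add, smul_mul_assoc, mul_smul_comm,
      map_add, map_smul, smul_sub, smul_add, ha, h3, star_sub, star_mul, hΦ.dualMap_star, mul_smul,
      smul_comm (star t) t]
    abel
  have h4 := ((ContinuousLinearMap.nonneg_iff_isPositive _).mp h1).inner_nonneg_left x
  rw [h2] at h4
  have h5 : ⟪star (D (star Y) a) x, x⟫_ℂ = star ⟪D (star Y) a x, x⟫_ℂ := by
    rw [ContinuousLinearMap.star_eq_adjoint, ContinuousLinearMap.adjoint_inner_left]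
    exact (inner_conj_symm _ _).symm
  simp only [add_apply, smul_apply, inner_add_left, inner_smul_left, h5, map_mul] at h4
  simpa using h4

theorem IsChannel.mul_map_of_star_mul_self (hΦ : IsChannel Φ) {a : H →L[ℂ] H}
    (ha : dualMap Φ (star a * a) = star (dualMap Φ a) * dualMap Φ a) (ρ : H →L[ℂ] H) :
    a * Φ ρ = Φ (dualMap Φ a * ρ) :=
  ext_opTrace_mul fun Y => by
    rw [← mul_assoc, opTrace_mul_comm, opTrace_mul_dualMap,
      hΦ.dualMap_mul_of_star_mul_self ha, opTrace_mul_comm Y, opTrace_mul_dualMap, mul_assoc,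
      opTrace_mul_comm (dualMap Φ a), mul_assoc]

/-- `Φ†(1 - P)` is positive with trace `tr(Φ(1)(1 - P)) = 0`, so it vanishes. Then `1 - P` attains
equality in Kadison-Schwarz, and the intertwining relation gives `(1 - P) Φ(ρ) = 0`. -/
theorem IsChannel.map_mul_range_proj (hΦ : IsChannel Φ) {P : H →L[ℂ] H}
    (hP : IsSelfAdjoint P) (hPP : P * P = P) (hR : P * Φ 1 = Φ 1) (ρ : H →L[ℂ] H) :
    P * Φ ρ = Φ ρ ∧ Φ ρ * P = Φ ρ := by
  have hs : star (1 - P) = 1 - P := by rw [star_sub, star_one, hP.star_eq]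
  have h2 : star (1 - P) * (1 - P) = 1 - P := by
    simp [hs, mul_sub, sub_mul, hPP]
  have h3 : dualMap Φ (1 - P) = 0 := by
    refine eq_zero_of_nonneg_of_opTrace ?_ ?_
    · rw [← map_zero (dualMap Φ), ← h2]
      exact hΦ.dualMap_mono (star_mul_self_nonneg _)
    · rw [← one_mul (dualMap Φ (1 - P)), ← opTrace_mul_dualMap, opTrace_mul_comm, sub_mul, hR,
        one_mul, sub_self, opTrace_zero]
  have h4 : ∀ σ, P * Φ σ = Φ σ := fun σ => by
    have h := hΦ.mul_map_of_star_mul_self (a := 1 - P) (by rw [h2, h3, mul_zero]) σ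
    rw [h3, zero_mul, map_zero, sub_mul, one_mul, sub_eq_zero] at h
    exact h.symm
  refine ⟨h4 ρ, ?_⟩
  have h := congrArg star (h4 (star ρ))
  rwa [star_mul, hP.star_eq, hΦ.map_star, star_star] at h

/-- If `Φ† ∘ R† = id_A`, then `R†(X)` implements multiplication by `X ∈ A` on the range of `Φ`. -/
theorem IsChannel.intertwines_of_leftInverse (hΦ : IsChannel Φ)
    {R : (H →L[ℂ] H) →ₗ[ℂ] (H →L[ℂ] H)} (hR : IsChannel R) {A : StarSubalgebra ℂ (H →L[ℂ] H)}
    (h : ∀ X ∈ A, dualMap Φ (dualMap R X) = X) {X : H →L[ℂ] H} (hX : X ∈ A) (ρ : H →L[ℂ] H) :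
    dualMap R X * Φ ρ = Φ (X * ρ) ∧ Φ ρ * dualMap R X = Φ (ρ * X) := by
  have key : ∀ Y ∈ A, ∀ σ, dualMap R Y * Φ σ = Φ (Y * σ) := by
    intro Y hY σ
    have h1 : dualMap Φ (star (dualMap R Y) * dualMap R Y)
        = star (dualMap Φ (dualMap R Y)) * dualMap Φ (dualMap R Y) := by
      -- The reverse inequality is Kadison-Schwarz for `R`, pushed through `Φ†`; it closes up
      -- because `X*X` again lies in `A`.
      refine le_antisymm ?_ (hΦ.star_dualMap_mul_dualMap_le _)
      rw [h Y hY]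
      calc _ ≤ _ := hΦ.dualMap_mono (hR.star_dualMap_mul_dualMap_le Y)
        _ = _ := h _ (mul_mem (star_mem hY) hY)
    rw [hΦ.mul_map_of_star_mul_self h1, h Y hY]
  refine ⟨key X hX ρ, ?_⟩
  have h2 := congrArg star (key (star X) (star_mem hX) (star ρ))
  rwa [star_mul, hR.dualMap_star, star_star, ← hΦ.map_star, ← hΦ.map_star, star_star, star_mul,
    star_star, star_star] at h2

end MultiplicativeDomain

/-! ### The representation obtained by compressing with `R^{+1/2}`. -/

section Representation

variable {H : Type*} [NormedAddCommGroup H] [InnerProductSpace ℂ H]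
  [CompleteSpace H]

theorem IsChannel.map_one_nonneg {Φ : (H →L[ℂ] H) →ₗ[ℂ] (H →L[ℂ] H)} (hΦ : IsChannel Φ) :
    0 ≤ Φ 1 := by
  obtain ⟨L, hL⟩ := hΦ.exists_star_mul_eq (1 : CStarMatrix (Fin 1) (Fin 1) (H →L[ℂ] H))
  have h := hL 0 0
  simp only [Fin.sum_univ_one, CStarMatrix.one_apply_eq, star_one, mul_one] at h
  rw [h]
  exact star_mul_self_nonneg _

theorem commute_pinv {R S : H →L[ℂ] H} (h : Commute R S) : Commute (pinv R) S :=
  h.cfc_real _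

theorem commute_pinvSqrt {R S : H →L[ℂ] H} (h : Commute R S) :
    Commute (pinvSqrt R) S :=
  (commute_pinv h).cfcₙ_nnreal _

variable [FiniteDimensional ℂ H]

/-- A family of operators intertwining a channel gives a representation by compression. -/
theorem IsChannel.exists_representation {Φ : (H →L[ℂ] H) →ₗ[ℂ] (H →L[ℂ] H)} (hΦ : IsChannel Φ)
    {A : StarSubalgebra ℂ (H →L[ℂ] H)} {S : (H →L[ℂ] H) → (H →L[ℂ] H)}
    (hl : ∀ X ∈ A, ∀ ρ, S X * Φ ρ = Φ (X * ρ)) (hr : ∀ X ∈ A, ∀ ρ, Φ ρ * S X = Φ (ρ * X)) :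
    ∃ π : A →⋆ₙₐ[ℂ] (H →L[ℂ] H),
      (∀ a : A, π a = pinvSqrt (Φ 1) * Φ (a : H →L[ℂ] H) * pinvSqrt (Φ 1)) ∧
      (A : Set (H →L[ℂ] H)) = genMultDomain Φ A π := by
  have hR := hΦ.map_one_nonneg
  set R := Φ 1 with hRdef
  set K := pinvSqrt R with hK
  obtain ⟨hK0, hKK⟩ := pinvSqrt_spec R hR
  have hKs : star K = K := hK0.isSelfAdjoint.star_eq
  obtain ⟨p1, p2, p3, p4⟩ := pinv_penrose R hR.isSelfAdjoint
  have hcR : Commute (pinv R) R := commute_pinv (Commute.refl R)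
  have hcK : Commute K R := commute_pinvSqrt (Commute.refl R)
  set P := pinv R * R with hP
  have hPP : P * P = P := by rw [hP, ← mul_assoc, p2]
  have hPR : P * R = R := by rw [hP, hcR.eq, p1]
  have hPΦ := hΦ.map_mul_range_proj p4 hPP hPR
  have hSR : ∀ X ∈ A, Φ X = S X * R := fun X hX => by rw [hRdef, hl X hX, mul_one]
  have hRS : ∀ X ∈ A, Commute R (S X) := fun X hX => by
    rw [Commute, SemiconjBy, ← hSR X hX, hRdef, hr X hX, one_mul]
  have hπ : ∀ X ∈ A, K * Φ X * K = S X * P := by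
    intro X hX
    rw [hSR X hX, ← mul_assoc, (commute_pinvSqrt (hRS X hX)).eq, mul_assoc, mul_assoc,
      ← hcK.eq, ← mul_assoc K, hKK]
  have hSP : ∀ X ∈ A, Commute P (S X) := fun X hX =>
    (commute_pinv (hRS X hX)).mul_left (hRS X hX)
  -- `S` need not be multiplicative: the relations only control it after multiplication by `R`, and
  -- cancelling `R` leaves the projection `P`.
  have hmul : ∀ X ∈ A, ∀ Y ∈ A, S (X * Y) * P = S X * P * (S Y * P) := by
    intro X hX Y hY
    have h1 : S (X * Y) * R = S X * S Y * R := by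
      rw [← hSR _ (mul_mem hX hY), ← hl X hX, hSR Y hY, mul_assoc]
    have h2 := congrArg (· * pinv R) h1
    simp only [mul_assoc, ← hcR.eq] at h2
    calc S (X * Y) * P = S X * (S Y * P) := h2
      _ = S X * (S Y * P * P) := by rw [mul_assoc (S Y), hPP]
      _ = _ := by rw [mul_assoc (S X) P, ← mul_assoc P (S Y), (hSP Y hY).eq]
  -- Linearity and `*`-preservation come from the formula in `Φ`, as `S` is an arbitrary function;
  -- only multiplicativity goes through `S X * P`.
  let π : A →⋆ₙₐ[ℂ] (H →L[ℂ] H) :=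
    { toFun := fun a => K * Φ (a : H →L[ℂ] H) * K
      map_smul' := fun c a => by simp
      map_zero' := by simp
      map_add' := fun a b => by simp [mul_add, add_mul]
      map_mul' := fun a b => by
        rw [hπ _ a.2, hπ _ b.2, hπ _ (a * b).2]
        exact hmul _ a.2 _ b.2
      map_star' := fun a => by
        rw [star_mul, star_mul, hKs, ← hΦ.map_star, mul_assoc]
        rfl }
  refine ⟨π, fun a => rfl, Set.Subset.antisymm (fun a ha => ⟨ha, fun X => ?_⟩) fun a ha => ha.1⟩
  have h1 : π ⟨a, ha⟩ = S a * P := hπ a ha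
  constructor
  · rw [h1, mul_assoc, (hPΦ X).1, hl a ha]
  · rw [h1, ← (hSP a ha).eq, ← mul_assoc, (hPΦ X).2, hr a ha]

end Representation

/-! ### Constructing the recovery channel by trace duality. -/

section Recovery

/-- Self-duality of the positive cone of a C⋆-algebra with respect to a faithful positive
functional. -/
theorem exists_eq_star_mul_self_of_functional_nonneg {B : Type*} [CStarAlgebra B]
    [PartialOrder B] [StarOrderedRing B] (τ : B →+ ℂ) (hτ : ∀ Z, 0 ≤ τ (star Z * Z))
    (hτ0 : ∀ Z, τ (star Z * Z) = 0 → Z = 0) {X : B} (hX : IsSelfAdjoint X)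
    (h : ∀ Z, 0 ≤ τ (X * (star Z * Z))) : ∃ W, X = star W * W := by
  apply exists_eq_star_mul_self_of_nonneg
  rw [← CFC.negPart_eq_zero_iff X hX]
  -- Testing against the negative part gives `0 ≤ τ(X X⁻) = -τ((X⁻)* X⁻)`, so faithfulness forces
  -- `X⁻ = 0`.
  have hn : 0 ≤ X⁻ := CFC.negPart_nonneg X
  obtain ⟨Z, hZ⟩ := exists_eq_star_mul_self_of_nonneg hn
  have h1 : X * X⁻ = -(star X⁻ * X⁻) :=
    calc X * X⁻ = (X⁺ - X⁻) * X⁻ := by rw [CFC.posPart_sub_negPart X hX]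
      _ = _ := by
        rw [sub_mul, CFC.posPart_mul_negPart, zero_sub, hn.isSelfAdjoint.star_eq]
  have h2 := h Z
  rw [← hZ, h1, map_neg] at h2
  exact hτ0 _ (le_antisymm (neg_nonneg.mp h2) (hτ _))

variable {H : Type*} [NormedAddCommGroup H] [InnerProductSpace ℂ H]
  [FiniteDimensional ℂ H] [CompleteSpace H] {A : StarSubalgebra ℂ (H →L[ℂ] H)}

/-- The positive cone of `M_k(A)` is self-dual with respect to the trace. -/
theorem exists_eq_star_mul_self_of_sum_opTrace_nonneg {k : ℕ}
    {X : CStarMatrix (Fin k) (Fin k) A} (hX : IsSelfAdjoint X)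
    (h : ∀ Z : CStarMatrix (Fin k) (Fin k) A,
      0 ≤ ∑ i, ∑ j, ∑ l, opTrace ((X i j : H →L[ℂ] H) * (star (Z l j : H →L[ℂ] H) * (Z l i : H →L[ℂ] H)))) :
    ∃ W, X = star W * W := by
  have : IsClosed (A : Set (H →L[ℂ] H)) :=
    Submodule.closed_of_finiteDimensional (Subalgebra.toSubmodule A.toSubalgebra)
  -- The C⋆-structure and order on `A` stay local; the factorization `X = W* W` mentions no order
  -- and so transfers to `L(H)`.
  let _ : CStarAlgebra A := StarSubalgebra.cstarAlgebra (S := StarSubalgebra ℂ (H →L[ℂ] H)) A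
  let _ : PartialOrder A := CStarAlgebra.spectralOrder A
  have : StarOrderedRing A := CStarAlgebra.spectralOrderedRing A
  let τ : CStarMatrix (Fin k) (Fin k) A →+ ℂ :=
    { toFun := fun Z => ∑ i, opTrace (Z i i : H →L[ℂ] H)
      map_zero' := by simp [CStarMatrix.zero_apply, opTrace_zero]
      map_add' := fun Y Z => by
        simp [CStarMatrix.add_apply, opTrace_add, Finset.sum_add_distrib] }
  have hτ : ∀ Z, τ (star Z * Z)
      = ∑ i, ∑ l, opTrace (star (Z l i : H →L[ℂ] H) * (Z l i : H →L[ℂ] H)) := by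
    intro Z
    simp [τ, CStarMatrix.mul_apply, CStarMatrix.star_apply, opTrace_sum]
  refine exists_eq_star_mul_self_of_functional_nonneg τ (fun Z => ?_) (fun Z hZ => ?_) hX
    fun Z => ?_
  · rw [hτ]
    exact Finset.sum_nonneg fun i _ => Finset.sum_nonneg fun l _ => opTrace_star_mul_self_nonneg _
  · rw [hτ, Finset.sum_eq_zero_iff_of_nonneg fun i _ =>
      Finset.sum_nonneg fun l _ => opTrace_star_mul_self_nonneg _] at hZ
    refine CStarMatrix.ext fun l i => ?_
    have h1 := hZ i (Finset.mem_univ i)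
    rw [Finset.sum_eq_zero_iff_of_nonneg fun l _ => opTrace_star_mul_self_nonneg _] at h1
    exact Subtype.ext (eq_zero_of_opTrace_star_mul_self (h1 l (Finset.mem_univ l)))
  · convert h Z using 1
    simp [τ, CStarMatrix.mul_apply, CStarMatrix.star_apply, opTrace_sum, Finset.mul_sum]

theorem eq_zero_of_forall_opTrace_mul {a : A}
    (h : ∀ c : A, opTrace ((a : H →L[ℂ] H) * (c : H →L[ℂ] H)) = 0) : a = 0 := by
  have h1 := h (star a)
  have h2 : star (a : H →L[ℂ] H) = 0 := eq_zero_of_opTrace_star_mul_self (by rwa [star_star])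
  exact Subtype.ext (star_eq_zero.mp h2)

theorem ext_opTrace_mul_subalgebra {a b : A} (h : ∀ c : A,
    opTrace ((a : H →L[ℂ] H) * (c : H →L[ℂ] H)) = opTrace ((b : H →L[ℂ] H) * (c : H →L[ℂ] H))) :
    a = b := by
  refine sub_eq_zero.mp (eq_zero_of_forall_opTrace_mul fun c => ?_)
  have h1 := sub_eq_zero.mpr (h c)
  rwa [opTrace_eq_opTraceₗ, opTrace_eq_opTraceₗ, ← map_sub, ← sub_mul] at h1

/-- The adjoint of a linear map `S : A → L(H)` with respect to the trace. -/
theorem exists_opTrace_adjoint (S : A →ₗ[ℂ] (H →L[ℂ] H)) :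
    ∃ R : (H →L[ℂ] H) →ₗ[ℂ] A, ∀ (ρ : H →L[ℂ] H) (a : A),
      opTrace ((R ρ : H →L[ℂ] H) * (a : H →L[ℂ] H)) = opTrace (ρ * S a) := by
  have : FiniteDimensional ℂ A :=
    FiniteDimensional.finiteDimensional_submodule (Subalgebra.toSubmodule A.toSubalgebra)
  let β : LinearMap.BilinForm ℂ A := LinearMap.mk₂ ℂ
    (fun a b => opTrace ((a : H →L[ℂ] H) * (b : H →L[ℂ] H)))
    (fun a b c => by simp [add_mul, opTrace_add]) (fun c a b => by simp [opTrace_smul])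
    (fun a b c => by simp [mul_add, opTrace_add]) (fun c a b => by simp [opTrace_smul])
  -- Pairing `a` with `a*` shows that the trace form on `A` is nondegenerate.
  have hβ : β.Nondegenerate := by
    refine ⟨fun a ha => eq_zero_of_forall_opTrace_mul ha, fun a ha =>
      eq_zero_of_forall_opTrace_mul fun c => ?_⟩
    rw [opTrace_mul_comm]
    exact ha c
  let F : (H →L[ℂ] H) →ₗ[ℂ] Module.Dual ℂ A := LinearMap.mk₂ ℂ
    (fun ρ a => opTrace (ρ * S a))
    (fun a b c => by simp [add_mul, opTrace_add]) (fun c a b => by simp [opTrace_smul])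
    (fun a b c => by simp [mul_add, opTrace_add]) (fun c a b => by simp [opTrace_smul])
  refine ⟨(β.toDual hβ).symm.toLinearMap ∘ₗ F, fun ρ a => ?_⟩
  exact LinearMap.BilinForm.apply_toDual_symm_apply (B := β) (hB := hβ) (F ρ) a

theorem sum_comm_pairs {ι M : Type*} [Fintype ι] [AddCommMonoid M] (g : ι → ι → ι → ι → M) :
    ∑ i, ∑ j, ∑ l, ∑ m, g i j l m = ∑ l, ∑ m, ∑ i, ∑ j, g i j l m := by
  calc _ = ∑ i, ∑ l, ∑ j, ∑ m, g i j l m := Finset.sum_congr rfl fun i _ => Finset.sum_comm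
    _ = ∑ l, ∑ i, ∑ j, ∑ m, g i j l m := Finset.sum_comm
    _ = ∑ l, ∑ i, ∑ m, ∑ j, g i j l m :=
      Finset.sum_congr rfl fun l _ => Finset.sum_congr rfl fun i _ => Finset.sum_comm
    _ = _ := Finset.sum_congr rfl fun l _ => Finset.sum_comm

/-- Trace adjoints of `a ↦ π(a) + (1 - π(1)) a (1 - π(1))` are channels. -/
theorem isChannel_of_opTrace_adjoint (π : A →⋆ₙₐ[ℂ] (H →L[ℂ] H))
    (R : (H →L[ℂ] H) →ₗ[ℂ] A)
    (hR : ∀ (ρ : H →L[ℂ] H) (a : A), opTrace ((R ρ : H →L[ℂ] H) * (a : H →L[ℂ] H))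
      = opTrace (ρ * (π a + (1 - π 1) * (a : H →L[ℂ] H) * (1 - π 1)))) :
    IsChannel (A.subtype.toAlgHom.toLinearMap ∘ₗ R) := by
  have hq : star (π 1) = π 1 := by rw [← map_star, star_one]
  have hqq : π 1 * π 1 = π 1 := by rw [← map_mul, mul_one]
  set E := 1 - π 1 with hE
  have hEs : star E = E := by rw [hE, star_sub, star_one, hq]
  have hEE : E * E = E := by simp [hE, mul_sub, sub_mul, hqq]
  have hRs : ∀ ρ, R (star ρ) = star (R ρ) := by
    intro ρ
    refine ext_opTrace_mul_subalgebra fun a => ?_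
    rw [hR]
    have h1 := congrArg star (hR ρ (star a))
    rw [← opTrace_star, ← opTrace_star, star_mul, star_mul, star_add, map_star, star_star,
      opTrace_mul_comm, opTrace_mul_comm _ (star ρ), star_mul, star_mul, hEs] at h1
    simpa [mul_assoc] using h1.symm
  have hE4 : ∀ n n' z z' : H →L[ℂ] H, opTrace (star n * n' * (E * (star z' * z) * E))
      = opTrace (z * E * star n * (n' * (E * star z'))) := by
    intro n n' z z'
    have h1 : star n * n' * (E * (star z' * z) * E)
        = star n * (n' * (E * star z')) * (z * E) := by simp only [mul_assoc]
    rw [h1, opTrace_mul_comm]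
    simp only [mul_assoc]
  constructor
  · intro k M hM
    obtain ⟨N, hN⟩ := exists_eq_star_mul_self_of_nonneg hM
    have hNe : ∀ i j, M i j = ∑ l, star (N l i) * N l j := fun i j => by
      rw [hN]; simp [CStarMatrix.mul_apply, CStarMatrix.star_apply]
    have hX : IsSelfAdjoint (M.map R) := by
      refine CStarMatrix.ext fun i j => ?_
      rw [CStarMatrix.star_apply, CStarMatrix.map_apply, CStarMatrix.map_apply, ← hRs,
        ← CStarMatrix.star_apply, hM.isSelfAdjoint.star_eq]
    -- By self-duality it suffices to pair with `Z* Z`. For fixed `l, m` the sum over `i, j` becomes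
    -- two terms `tr(F F*)`, with `F = ∑ᵢ π(Z l i) (N m i)*` from `π` and `F = ∑ᵢ Z l i E (N m i)*`
    -- from the corner.
    obtain ⟨W, hW⟩ := exists_eq_star_mul_self_of_sum_opTrace_nonneg hX fun Z => by
      have h1 : ∀ i j l, opTrace ((R (M i j) : H →L[ℂ] H) *
            (star (Z l j : H →L[ℂ] H) * (Z l i : H →L[ℂ] H)))
          = ∑ m, (opTrace (π (Z l i) * star (N m i) * (N m j * star (π (Z l j))))
            + opTrace ((Z l i : H →L[ℂ] H) * E * star (N m i) *
              (N m j * (E * star (Z l j : H →L[ℂ] H))))) := by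
        intro i j l
        have h2 := hR (M i j) (star (Z l j) * Z l i)
        rw [map_mul, map_star, hNe, mul_add, opTrace_add, Finset.sum_mul, Finset.sum_mul,
          opTrace_sum, opTrace_sum, ← Finset.sum_add_distrib, ← hNe] at h2
        refine h2.trans (Finset.sum_congr rfl fun m _ => ?_)
        congr 1
        · rw [mul_assoc (π (Z l i)), opTrace_mul_comm (π (Z l i))]
          simp only [mul_assoc]
        · exact hE4 _ _ _ _
      have h3 : ∀ F : Fin k → (H →L[ℂ] H), 0 ≤ ∑ i, ∑ j, opTrace (F i * star (F j)) := by
        intro F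
        have h4 : ∑ i, ∑ j, opTrace (F i * star (F j))
            = opTrace (star (star (∑ i, F i)) * star (∑ i, F i)) := by
          simp only [star_star, star_sum, Finset.mul_sum, Finset.sum_mul, opTrace_sum]
          exact Finset.sum_comm
        rw [h4]
        exact opTrace_star_mul_self_nonneg _
      simp only [CStarMatrix.map_apply, h1]
      rw [sum_comm_pairs]
      refine Finset.sum_nonneg fun l _ => Finset.sum_nonneg fun m _ => ?_
      simp only [Finset.sum_add_distrib]
      refine add_nonneg ?_ ?_
      · simpa [mul_assoc] using h3 fun i => π (Z l i) * star (N m i)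
      · simpa [mul_assoc, hEs] using h3 fun i => (Z l i : H →L[ℂ] H) * E * star (N m i)
    have h4 : M.map (A.subtype.toAlgHom.toLinearMap ∘ₗ R)
        = star (W.map (Subtype.val)) * W.map Subtype.val := by
      refine CStarMatrix.ext fun i j => ?_
      have h5 := congrArg (fun Y : CStarMatrix (Fin k) (Fin k) A => (Y i j : H →L[ℂ] H)) hW
      simpa [CStarMatrix.mul_apply, CStarMatrix.star_apply] using h5
    rw [h4]
    exact star_mul_self_nonneg _
  · intro ρ
    -- Trace preservation is unitality of the adjoint: at `a = 1` the right side is `π(1) + E = 1`.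
    have h1 := hR ρ 1
    simp only [OneMemClass.coe_one, mul_one, hEE] at h1
    simpa [hE] using h1

/-- A representation intertwining `Φ` makes the algebra correctable. -/
theorem isCorrectable_of_intertwines {Φ : (H →L[ℂ] H) →ₗ[ℂ] (H →L[ℂ] H)}
    (hΦ : IsChannel Φ) (π : A →⋆ₙₐ[ℂ] (H →L[ℂ] H))
    (hr : ∀ (a : A) ρ, Φ (ρ * (a : H →L[ℂ] H)) = Φ ρ * π a) :
    IsCorrectable Φ A := by
  let S : A →ₗ[ℂ] (H →L[ℂ] H) :=
    { toFun := fun a => π a + (1 - π 1) * (a : H →L[ℂ] H) * (1 - π 1)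
      map_add' := fun a b => by simp [mul_add, add_mul]; abel
      map_smul' := fun c a => by simp }
  obtain ⟨R, hR⟩ := exists_opTrace_adjoint S
  refine ⟨R, isChannel_of_opTrace_adjoint π R hR, fun X => ?_⟩
  have h1 : dualMap (A.subtype.toAlgHom.toLinearMap ∘ₗ R) (X : H →L[ℂ] H) = S X :=
    ext_opTrace_mul fun ρ => by rw [← opTrace_mul_dualMap, ← hR]; rfl
  rw [h1]
  refine ext_opTrace_mul fun ρ => ?_
  -- Intertwining at `a = 1` reads `Φ(ρ) = Φ(ρ) π(1)`, so `Φ(ρ)` annihilates the corner.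
  have h2 : Φ ρ * ((1 - π 1) * (X : H →L[ℂ] H) * (1 - π 1)) = 0 := by
    have h3 := hr 1 ρ
    rw [OneMemClass.coe_one, mul_one] at h3
    have h4 : Φ ρ * (1 - π 1) = 0 := by rw [mul_sub, mul_one, ← h3, sub_self]
    rw [← mul_assoc, ← mul_assoc, h4, zero_mul, zero_mul]
  change _ = opTrace (ρ * (X : H →L[ℂ] H))
  rw [← opTrace_mul_dualMap]
  change opTrace (Φ ρ * (π X + (1 - π 1) * (X : H →L[ℂ] H) * (1 - π 1))) = _
  rw [mul_add, h2, add_zero, ← hr, hΦ.tracePreserving]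

end Recovery

end OAQEC

theorem mainTheorem3 {H : Type*} [NormedAddCommGroup H] [InnerProductSpace ℂ H]
    [FiniteDimensional ℂ H] [CompleteSpace H]
    (Φ : (H →L[ℂ] H) →ₗ[ℂ] (H →L[ℂ] H)) (hΦ : OAQEC.IsChannel Φ)
    (A : StarSubalgebra ℂ (H →L[ℂ] H)) :
    (OAQEC.IsCorrectable Φ A ↔
      ∃ π : A →⋆ₙₐ[ℂ] (H →L[ℂ] H),
        (A : Set (H →L[ℂ] H)) = OAQEC.genMultDomain Φ A π) ∧
    (OAQEC.IsCorrectable Φ A →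
      ∃ π : A →⋆ₙₐ[ℂ] (H →L[ℂ] H),
        (∀ a : A, π a =
          OAQEC.pinvSqrt (Φ 1) * Φ (a : H →L[ℂ] H) * OAQEC.pinvSqrt (Φ 1)) ∧
        (A : Set (H →L[ℂ] H)) = OAQEC.genMultDomain Φ A π) := by
  have hcorr : OAQEC.IsCorrectable Φ A →
      ∃ π : A →⋆ₙₐ[ℂ] (H →L[ℂ] H),
        (∀ a : A, π a =
          OAQEC.pinvSqrt (Φ 1) * Φ (a : H →L[ℂ] H) * OAQEC.pinvSqrt (Φ 1)) ∧
        (A : Set (H →L[ℂ] H)) = OAQEC.genMultDomain Φ A π := by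
    rintro ⟨R, hR, hinv⟩
    have h : ∀ X ∈ A, OAQEC.dualMap Φ
        (OAQEC.dualMap (A.subtype.toAlgHom.toLinearMap ∘ₗ R) X) = X := fun X hX => hinv ⟨X, hX⟩
    exact hΦ.exists_representation
      (fun X hX ρ => (hΦ.intertwines_of_leftInverse hR h hX ρ).1)
      (fun X hX ρ => (hΦ.intertwines_of_leftInverse hR h hX ρ).2)
  refine ⟨⟨fun h => ?_, ?_⟩, hcorr⟩
  · obtain ⟨π, -, hπ⟩ := hcorr h
    exact ⟨π, hπ⟩
  · rintro ⟨π, hπ⟩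
    refine OAQEC.isCorrectable_of_intertwines hΦ π fun a ρ => ?_
    have ha : (a : H →L[ℂ] H) ∈ OAQEC.genMultDomain Φ A π := hπ ▸ a.2
    obtain ⟨_, h⟩ := ha
    exact (h ρ).2
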